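/- Let $T$ be a finite tree with $n$ vertices. \emph{Game.} In two-player competitive diffusion on $T$, Player 1 and Player 2 choose starting vertices $x,y$, which receive their respective colours (if $x=y$, this vertex turns grey). In each wave, an uncoloured vertex with neighbours of both players' colours turns grey, and an uncoloured vertex with neighbours of exactly one player's colour inherits that colour; coloured and grey vertices never change. Let $A_T(x,y)$ be the final number of vertices with Player 1's colour. For mixed strategies (probability vectors on the vertex set $V$) $X,Y$ let $Gain(T,X,Y)=XA_TY^{T}$, let $Z(v)$ be the pure strategy choosing $v$, and let $GGain(T,X)=\min_Y Gain(T,X,Y)$, the minimum being over all mixed strategies $Y$ of Player 2. \emph{Weights.} A branch of $T$ at a vertex $v$ is a maximal subtree having $v$ as a leaf; $w(v)$ is the maximum number of edges in a branch at $v$ (it is $0$ if $n=1$), and $\overline w(v)=n-w(v)$. Assume that $T$ is centroidal, i.e. exactly one vertex $c$, the centroid, has minimal weight. The vertices of a branch at $c$ are understood to exclude $c$ itself. For a branch at $c$ with at least three vertices let $u,t,s$ be distinct vertices of it with $w(u)\le w(t)\le w(s)\le w(v)$ for every other vertex $v$ of it. The branch is thick if $w(t)\ge n-w(u)+\frac{w(u)^2}{n}$;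 otherwise it is medium if $w(s)\ge n-w(t)+\frac{w(t)^2+(w(t)-w(u))^2}{n+(w(t)-w(u))}$, and thin if this fails too. A branch with one or two vertices is treated as thick, with $u$ a vertex of lowest weight. The criterion $Cr(B)$ of a branch $B$ at $c$ is $0$ if $B$ has fewer than three vertices, and otherwise it is $$\overline w(u)\ \text{(thick)},\qquad \frac{\overline w(t)}{n}\overline w(u)+\frac{w(t)}{n}\overline w(t)\ \text{(medium)},$$ $$\frac{w(t)\overline w(t)\left(n^2-nw(s)-w(s)w(t)+w(t)^2+2w(s)w(u)-w(t)w(u)\right)}{nw(t)\overline w(s)+w(u)w(t)(-n+w(s)+w(t))+\overline w(t)w(u)^2}\ \text{(thin)}.$$ \emph{Probabilities on a branch.} Given $\alpha$, the vertices $u,t,s$ of a branch receive $\beta,\gamma,\delta$ and its other vertices receive $0$, where: for a thick branch $\beta=\frac{w(u)}{\overline w(u)}\alpha$, $\gamma=\delta=0$; for a medium branch $\beta=\frac{w(u)}{\overline w(u)}\alpha$, $\gamma=\frac{w(t)}{\overline w(t)}\beta$, $\delta=0$; for a thin branch $$\beta=\frac{\overline w(t)\left(w(u)\overline w(s)+(w(t)-w(s))(w(t)-w(u))\right)}{\overline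 w(s)\overline w(u)\overline w(t)+w(s)w(t)(w(s)-w(t))}\,\alpha,\quad \gamma=\frac{w(t)}{\overline w(t)}\beta,\quad \delta=\frac{w(s)}{\overline w(s)}\gamma+\frac{w(t)-w(u)}{\overline w(s)}\alpha .$$ \emph{Centroidal Safe Strategy algorithm.} Order the $d$ branches at $c$ as $B_1,\dots,B_d$ with $Cr(B_i)\ge Cr(B_{i+1})$. For $0\le i\le d$ let $\sigma_i$ assign $\alpha$ to $c$, the above probabilities in terms of $\alpha$ to the vertices of $B_1,\dots,B_i$, and $0$ to all other vertices, where $\alpha$ is determined by the condition that the entries of $\sigma_i$ sum to $1$. Start with $i=0$. If $i<d$ and $Cr(B_{i+1})\ge Gain(T,\sigma_i,Z(c))$, pass from $i$ to $i+1$; if $i=d$, or $i<d$ and $Cr(B_{i+1})\le Gain(T,\sigma_i,Z(c))$, return $\sigma_i$ (in case of equality either may be done). Ties in the choice of $u,t,s$ and in the ordering of the branches are broken arbitrarily. \textbf{Theorem.} Whenever the algorithm, applied to a centroidal tree $T$ with centroid $c$, returns $\sigma_k$, the vector $\sigma_k$ is a mixed strategy and $$GGain(T,\sigma_k)=Gain(T,\sigma_k,Z(c)).$$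 In other words, $Gain(T,\sigma_k,Z(c))\le Gain(T,\sigma_k,Y)$ for every mixed strategy $Y$ of Player 2: the centroid is Player 2's best response to $\sigma_k$. -/

import Mathlib

namespace CompetitiveDiffusion

/-! ### The two-player competitive diffusion process -/

/-- State of a vertex: uncoloured, grey, or carrying the colour of one of the two players. -/
inductive Colour where
  | white : Colour
  | grey : Colour
  | player1 : Colour
  | player2 : Colour

open Classical in
/-- The starting colouring when Player 1 chooses `x` and Player 2 chooses `y`; a common starting
vertex is grey. -/
noncomputable def initialColouring {V : Type*} (x y : V) (v : V) : Colour :=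
  if v = x ∧ v = y then Colour.grey
  else if v = x then Colour.player1
  else if v = y then Colour.player2
  else Colour.white

open Classical in
/-- One wave of diffusion. Only white vertices change: such a vertex turns grey if it has neighbours
of both players' colours, and inherits a player's colour if only that colour occurs among its
neighbours. -/
noncomputable def wave {V : Type*} (G : SimpleGraph V) (f : V → Colour) (v : V) : Colour :=
  match f v with
  | Colour.white =>
    if (∃ w, G.Adj v w ∧ f w = Colour.player1) ∧ (∃ w, G.Adj v w ∧ f w = Colour.player2) then
      Colour.grey
    else if ∃ w, G.Adj v w ∧ f w = Colour.player1 then Colour.player1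
    else if ∃ w, G.Adj v w ∧ f w = Colour.player2 then Colour.player2
    else Colour.white
  | a => a

/-- The colouring after `m` waves. -/
noncomputable def colouring {V : Type*} (G : SimpleGraph V) (x y : V) (m : ℕ) : V → Colour :=
  (wave G)^[m] (initialColouring x y)

/-- The gain of Player 1: the number of vertices that assume her colour (a coloured vertex keeps its
colour forever). -/
noncomputable def gain {V : Type*} (G : SimpleGraph V) (x y : V) : ℕ :=
  {v : V | ∃ m, colouring G x y m v = Colour.player1}.ncard

/-! ### Mixed strategies -/

/-- The game matrix of Player 1. -/
noncomputable def gameMatrix {V : Type*} (G : SimpleGraph V) : Matrix V V ℝ :=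
  Matrix.of fun x y => (gain G x y : ℝ)

/-- `Gain(G, X, Y) = X A_G Yᵀ`. -/
noncomputable def expectedGain {V : Type*} [Fintype V] (G : SimpleGraph V) (X Y : V → ℝ) : ℝ :=
  X ⬝ᵥ (gameMatrix G).mulVec Y

open Classical in
/-- The pure strategy `Z(v)`, as a vector. -/
noncomputable def pureStrategy {V : Type*} (v : V) : V → ℝ := Pi.single v 1

/-- The guaranteed gain of Player 1 with the strategy `X`: the minimum of her expected gain over all
mixed strategies of Player 2. -/
noncomputable def guaranteedGain {V : Type*} [Fintype V] (G : SimpleGraph V) (X : V → ℝ) : ℝ :=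
  sInf ((fun Y => expectedGain G X Y) '' stdSimplex ℝ V)

/-! ### Branches, weights and the centroid of a tree -/

/-- `S` is the vertex set of a subtree of `T` that has `v` as a leaf. (A subtree of a tree is an
induced subgraph, so that it is determined by its vertex set.) -/
def IsSubtreeWithLeaf {V : Type*} (T : SimpleGraph V) (v : V) (S : Set V) : Prop :=
  (T.induce S).IsTree ∧ v ∈ S ∧ ∃! w, w ∈ S ∧ T.Adj v w

/-- `S` is the vertex set of a branch of `T` at `v`: a maximal subtree having `v` as a leaf. -/
def IsBranch {V : Type*} (T : SimpleGraph V) (v : V) (S : Set V) : Prop :=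
  Maximal (IsSubtreeWithLeaf T v) S

/-- The weight `w(v)`: the maximum number of edges in a branch at `v` (and `0` for the vertex of a
one-point tree, which has no branches). -/
noncomputable def weight {V : Type*} (T : SimpleGraph V) (v : V) : ℕ :=
  sSup {m | ∃ S, IsBranch T v S ∧ (T.induce S).edgeSet.ncard = m}

/-- The set of vertices of minimal weight. -/
def centroid {V : Type*} (T : SimpleGraph V) : Set V :=
  {v | ∀ u, weight T v ≤ weight T u}

/-- The weight `w(v)` as a real number. -/
noncomputable def wt {V : Type*} (T : SimpleGraph V) (v : V) : ℝ := (weight T v : ℝ)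

/-- `w̄(v) = n - w(v)`, where `n` is the number of vertices. -/
noncomputable def cowt {V : Type*} (T : SimpleGraph V) (v : V) : ℝ := (Nat.card V : ℝ) - wt T v

/-! ### Types of branches at the centroid

A branch at the centroid `c` is handled through a list `u, t, s, …` of its vertices other than `c`
by nondecreasing weight, so that `u`, `t`, `s` have the lowest, second lowest and third lowest
weight. -/

/-- `l` lists, without repetition and by nondecreasing weight, the vertices other than `c` of the
branch at `c` with vertex set `S`. -/
def IsSortedEnumeration {V : Type*} (T : SimpleGraph V) (c : V) (S : Set V) (l : List V) : Prop :=
  l.Nodup ∧ (∀ v, v ∈ l ↔ v ∈ S ∧ v ≠ c) ∧ l.Pairwise fun x y => weight T x ≤ weight T y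

inductive BranchType where
  | thick : BranchType
  | medium : BranchType
  | thin : BranchType

open Classical in
/-- The type of a branch whose three vertices of lowest weight are `u, t, s`, in this order. -/
noncomputable def branchType {V : Type*} (T : SimpleGraph V) (u t s : V) : BranchType :=
  let n : ℝ := Nat.card V
  if n - wt T u + wt T u ^ 2 / n ≤ wt T t then BranchType.thick
  else if n - wt T t + (wt T t ^ 2 + (wt T t - wt T u) ^ 2) / (n + (wt T t - wt T u)) ≤ wt T s then
    BranchType.medium
  else BranchType.thin

/-- The criterion `Cr` of a branch; it is `0` if the branch has fewer than three vertices (the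
centroid not being counted). -/
noncomputable def criterion {V : Type*} (T : SimpleGraph V) : List V → ℝ
  | u :: t :: s :: _ =>
    let n : ℝ := Nat.card V
    match branchType T u t s with
    | BranchType.thick => cowt T u
    | BranchType.medium => cowt T t / n * cowt T u + wt T t / n * cowt T t
    | BranchType.thin =>
      wt T t * cowt T t *
          (n ^ 2 - n * wt T s - wt T s * wt T t + wt T t ^ 2 + 2 * wt T s * wt T u
            - wt T t * wt T u) /
        (n * wt T t * cowt T s + wt T u * wt T t * (-n + wt T s + wt T t)
          + cowt T t * wt T u ^ 2)
  | _ => 0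

/-! ### The probabilities assigned to a branch, when the centroid has probability `α` -/

/-- `β` for a thin branch. -/
noncomputable def thinBeta {V : Type*} (T : SimpleGraph V) (α : ℝ) (u t s : V) : ℝ :=
  cowt T t * (wt T u * cowt T s + (wt T t - wt T s) * (wt T t - wt T u)) /
    (cowt T s * cowt T u * cowt T t + wt T s * wt T t * (wt T s - wt T t)) * α

/-- `γ` for a thin branch. -/
noncomputable def thinGamma {V : Type*} (T : SimpleGraph V) (α : ℝ) (u t s : V) : ℝ :=
  wt T t / cowt T t * thinBeta T α u t s

/-- `δ` for a thin branch. -/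
noncomputable def thinDelta {V : Type*} (T : SimpleGraph V) (α : ℝ) (u t s : V) : ℝ :=
  wt T s / cowt T s * thinGamma T α u t s + (wt T t - wt T u) / cowt T s * α

/-- `β` for a medium or a thick branch. -/
noncomputable def baseBeta {V : Type*} (T : SimpleGraph V) (α : ℝ) (u : V) : ℝ :=
  wt T u / cowt T u * α

/-- `γ` for a medium branch. -/
noncomputable def mediumGamma {V : Type*} (T : SimpleGraph V) (α : ℝ) (u t : V) : ℝ :=
  wt T t / cowt T t * baseBeta T α u

/-- The probabilities on the vertices of a branch. A branch with fewer than three vertices is treated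
as thick: with two vertices it always satisfies the inequality of a thick branch, and with one vertex
there is no second lowest weight. -/
noncomputable def branchStrategy {V : Type*} (T : SimpleGraph V) (α : ℝ) : List V → V → ℝ
  | u :: t :: s :: _ =>
    match branchType T u t s with
    | BranchType.thick => baseBeta T α u • pureStrategy u
    | BranchType.medium =>
      baseBeta T α u • pureStrategy u + mediumGamma T α u t • pureStrategy t
    | BranchType.thin =>
      thinBeta T α u t s • pureStrategy u + thinGamma T α u t s • pureStrategy t
        + thinDelta T α u t s • pureStrategy s
  | u :: _ => baseBeta T α u • pureStrategy u
  | [] => 0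

/-! ### The Centroidal Safe Strategy algorithm -/

/-- Step 1: an ordering `B` of the `d` branches at `c` by nonincreasing criterion, together with a
listing `L i` of the vertices of the branch `B i` by nondecreasing weight (ties are broken
arbitrarily in both). Branches are numbered from `0`. -/
structure IsBranchOrdering {V : Type*} (T : SimpleGraph V) (c : V) {d : ℕ}
    (B : Fin d → Set V) (L : Fin d → List V) : Prop where
  injective : Function.Injective B
  range_eq : Set.range B = {S | IsBranch T c S}
  enumeration : ∀ i, IsSortedEnumeration T c (B i) (L i)
  antitone : ∀ i j, i ≤ j → criterion T (L j) ≤ criterion T (L i)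

/-- The vector that has entry `α` at the centroid and the prescribed probabilities in terms of `α`
on the first `i` branches. -/
noncomputable def spread {V : Type*} (T : SimpleGraph V) (c : V) {d : ℕ} (L : Fin d → List V)
    (i : ℕ) (α : ℝ) : V → ℝ :=
  α • pureStrategy c + ∑ j : Fin d with j.val < i, branchStrategy T α (L j)

/-- The probability `α` of the centroid in `σ_i`. All entries of `spread T c L i α` are proportional
to `α`, so that this is the solution of the equation saying that they sum to `1`. -/
noncomputable def centroidProb {V : Type*} [Fintype V] (T : SimpleGraph V) (c : V) {d : ℕ}
    (L : Fin d → List V) (i : ℕ) : ℝ :=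
  (∑ v, spread T c L i 1 v)⁻¹

/-- The strategy `σ_i`. -/
noncomputable def cssStrategy {V : Type*} [Fintype V] (T : SimpleGraph V) (c : V) {d : ℕ}
    (L : Fin d → List V) (i : ℕ) : V → ℝ :=
  spread T c L i (centroidProb T c L i)

/-- Steps 2 to 4: starting from `σ_0`, the algorithm may pass from `σ_i` to `σ_{i+1}` if the
criterion of the next branch is at least `Gain(T, σ_i, Z(c))`. -/
inductive Reaches {V : Type*} [Fintype V] (T : SimpleGraph V) (c : V) {d : ℕ}
    (L : Fin d → List V) : ℕ → Prop
  | zero : Reaches T c L 0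
  | succ (i : ℕ) (hi : i < d) (h : Reaches T c L i)
      (hcr : expectedGain T (cssStrategy T c L i) (pureStrategy c) ≤ criterion T (L ⟨i, hi⟩)) :
      Reaches T c L (i + 1)

/-- The algorithm may return `σ_k`: it reaches `σ_k`, and either all branches have been used or the
criterion of the next branch is at most `Gain(T, σ_k, Z(c))`. (In case of equality it may continue
or stop.) -/
def Returns {V : Type*} [Fintype V] (T : SimpleGraph V) (c : V) {d : ℕ}
    (L : Fin d → List V) (k : ℕ) : Prop :=
  Reaches T c L k ∧
    (k = d ∨ ∃ hk : k < d,
      criterion T (L ⟨k, hk⟩) ≤ expectedGain T (cssStrategy T c L k) (pureStrategy c))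

end CompetitiveDiffusion

namespace CompetitiveDiffusion

open SimpleGraph

variable {V : Type*} {T : SimpleGraph V}

/-! ### Distances in a tree -/

/-- The vertex `y` lies on a geodesic from `x` to `z`. -/
def Between (T : SimpleGraph V) (x y z : V) : Prop := T.dist x y + T.dist y z = T.dist x z

lemma Between.symm {x y z : V} (h : Between T x y z) : Between T z y x := by
  unfold Between at *
  rw [T.dist_comm (u := z) (v := y), T.dist_comm (u := y) (v := x), T.dist_comm (u := z) (v := x)]
  omega

lemma mem_support_of_between (hT : T.IsTree) {x y z : V} (h : Between T x y z)
    (p : T.Walk x z) : y ∈ p.support := by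
  classical
  obtain ⟨q, hq⟩ := hT.connected.exists_walk_length_eq_dist x y
  obtain ⟨r, hr⟩ := hT.connected.exists_walk_length_eq_dist y z
  have hpath : (q.append r).IsPath := by
    apply Walk.isPath_of_length_eq_dist
    rw [Walk.length_append, hq, hr]
    exact h
  have heq : p.bypass = q.append r :=
    congrArg Subtype.val
      ((hT.isAcyclic.subsingleton_path x z).elim ⟨p.bypass, p.bypass_isPath⟩ ⟨q.append r, hpath⟩)
  apply p.support_bypass_subset_support
  rw [heq, Walk.mem_support_append_iff]
  exact Or.inl q.end_mem_support

lemma between_of_mem_support (hT : T.IsTree) {x y z : V} {p : T.Walk x z}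
    (hp : p.length = T.dist x z) (hy : y ∈ p.support) : Between T x y z := by
  classical
  have h1 := congrArg Walk.length (p.take_spec hy)
  rw [Walk.length_append] at h1
  have h2 := T.dist_le (p.takeUntil y hy)
  have h3 := T.dist_le (p.dropUntil y hy)
  have h4 := hT.connected.dist_triangle (u := x) (v := y) (w := z)
  unfold Between
  omega

/-- A vertex between `x` and `z` separates every vertex from `x` or from `z`. -/
lemma Between.or (hT : T.IsTree) {x y z : V} (h : Between T x y z) (v : V) :
    Between T v y x ∨ Between T v y z := by
  obtain ⟨p, hp⟩ := hT.connected.exists_walk_length_eq_dist v x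
  obtain ⟨q, hq⟩ := hT.connected.exists_walk_length_eq_dist v z
  have := mem_support_of_between hT h (p.reverse.append q)
  rw [Walk.mem_support_append_iff, Walk.support_reverse, List.mem_reverse] at this
  exact this.imp (between_of_mem_support hT hp) (between_of_mem_support hT hq)

lemma exists_adj_dist_add_one (hT : T.IsTree) {x v : V} (h : v ≠ x) :
    ∃ w, T.Adj v w ∧ T.dist w x + 1 = T.dist v x := by
  obtain ⟨p, hp⟩ := hT.connected.exists_walk_length_eq_dist v x
  cases p with
  | nil => exact absurd rfl h
  | @cons _ w _ hvw q =>
    refine ⟨w, hvw, ?_⟩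
    have h1 := T.dist_le q
    have h2 := hT.connected.dist_triangle (u := v) (v := w) (w := x)
    rw [dist_eq_one_iff_adj.mpr hvw] at h2
    rw [Walk.length_cons] at hp
    omega

lemma dist_adj (hT : T.IsTree) {v w : V} (h : T.Adj v w) (x : V) :
    T.dist v x = T.dist w x + 1 ∨ T.dist w x = T.dist v x + 1 := by
  have := hT.dist_eq_dist_add_one_of_adj x h
  rwa [T.dist_comm (u := x) (v := v), T.dist_comm (u := x) (v := w)] at this

lemma eq_of_adj_of_dist_add_one (hT : T.IsTree) {x v w w' : V} (h : T.Adj v w) (h' : T.Adj v w')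
    (hw : T.dist w x + 1 = T.dist v x) (hw' : T.dist w' x + 1 = T.dist v x) : w = w' := by
  have hb : Between T v w x := by
    unfold Between
    rw [dist_eq_one_iff_adj.mpr h]
    omega
  have key : T.dist w' w = 0 := by
    rcases hb.or hT w' with h1 | h1
    · unfold Between at h1
      rw [dist_eq_one_iff_adj.mpr h.symm, dist_eq_one_iff_adj.mpr h'.symm] at h1
      omega
    · unfold Between at h1
      omega
  exact ((hT.connected.dist_eq_zero_iff).mp key).symm

/-! ### The outcome of the diffusion process on a tree -/

lemma dist_lt_of_adj_of_dist_lt (hT : T.IsTree) {x y v w : V} {m : ℕ} (hvw : T.Adj v w)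
    (hm : T.dist w x ≤ m) (hlt : T.dist w x < T.dist w y)
    (hv : ¬ (T.dist v y ≤ m ∧ T.dist v y < T.dist v x))
    (hn : ∀ w', T.Adj v w' → ¬ (T.dist w' y ≤ m ∧ T.dist w' y < T.dist w' x)) :
    T.dist v x < T.dist v y := by
  by_contra hcon
  have hx := dist_adj hT hvw x
  have hy := dist_adj hT hvw y
  have hvy : v ≠ y := by
    rintro rfl
    rw [dist_self] at hv
    have : T.dist v x = 0 := by omega
    rw [dist_self] at hy
    omega
  obtain ⟨w', hw', hd⟩ := exists_adj_dist_add_one hT hvy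
  have hn' := hn w' hw'
  have hx' := dist_adj hT hw' x
  have heq : T.dist w' x + 1 = T.dist v x := by omega
  have : w = w' := eq_of_adj_of_dist_add_one (x := x) hT hvw hw' (by omega) heq
  subst this
  omega

lemma exists_adj_and_forall_adj_of_dist_lt (hT : T.IsTree) {x y v : V} {m : ℕ}
    (hm : T.dist v x = m + 1) (hlt : T.dist v x < T.dist v y) :
    (∃ w, T.Adj v w ∧ T.dist w x ≤ m ∧ T.dist w x < T.dist w y) ∧
      ∀ w, T.Adj v w → ¬ (T.dist w y ≤ m ∧ T.dist w y < T.dist w x) := by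
  have hvx : v ≠ x := by
    rintro rfl
    rw [dist_self] at hm
    omega
  constructor
  · obtain ⟨w, hw, hd⟩ := exists_adj_dist_add_one hT hvx
    have := dist_adj hT hw y
    exact ⟨w, hw, by omega, by omega⟩
  · intro w hw
    have := dist_adj hT hw y
    omega

lemma colouring_iff_dist (hT : T.IsTree) (x y : V) (m : ℕ) : ∀ v,
    (colouring T x y m v = Colour.player1 ↔ T.dist v x ≤ m ∧ T.dist v x < T.dist v y) ∧
    (colouring T x y m v = Colour.player2 ↔ T.dist v y ≤ m ∧ T.dist v y < T.dist v x) ∧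
    (colouring T x y m v = Colour.grey → T.dist v x = T.dist v y) := by
  induction m with
  | zero =>
    intro v
    have h0 : ∀ z, T.dist v z = 0 ↔ v = z := fun z => hT.connected.dist_eq_zero_iff
    have hx := h0 x
    have hy := h0 y
    simp only [colouring, Function.iterate_zero, id, initialColouring]
    split_ifs with h1 h2 h3
    · have := hx.mpr h1.1
      have := hy.mpr h1.2
      simp only [false_iff, true_imp_iff]
      omega
    · have := hx.mpr h2
      have : T.dist v y ≠ 0 := fun h => h1 ⟨h2, hy.mp h⟩
      simp only [and_true, false_iff, true_iff, false_imp_iff]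
      omega
    · have := hy.mpr h3
      have : T.dist v x ≠ 0 := fun h => h2 (hx.mp h)
      simp only [and_true, false_iff, true_iff, false_imp_iff]
      omega
    · have : T.dist v x ≠ 0 := fun h => h2 (hx.mp h)
      have : T.dist v y ≠ 0 := fun h => h3 (hy.mp h)
      simp only [and_true, false_iff, false_imp_iff]
      omega
  | succ m ih =>
    intro v
    have hstep : colouring T x y (m + 1) v = wave T (colouring T x y m) v := by
      simp only [colouring, Function.iterate_succ_apply']
    obtain ⟨h1, h2, h3⟩ := ih v
    have e1 : (∃ w, T.Adj v w ∧ colouring T x y m w = Colour.player1) ↔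
        ∃ w, T.Adj v w ∧ T.dist w x ≤ m ∧ T.dist w x < T.dist w y :=
      exists_congr fun w => and_congr_right fun _ => (ih w).1
    have e2 : (∃ w, T.Adj v w ∧ colouring T x y m w = Colour.player2) ↔
        ∃ w, T.Adj v w ∧ T.dist w y ≤ m ∧ T.dist w y < T.dist w x :=
      exists_congr fun w => and_congr_right fun _ => (ih w).2.1
    rw [hstep]
    unfold wave
    rw [e1, e2]
    rcases hc : colouring T x y m v with _ | _ | _ | _
    · simp only [hc, reduceCtorEq, false_iff, false_imp_iff] at h1 h2 h3
      simp only []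
      split_ifs with g1 g2 g3
      · obtain ⟨⟨w, hw, hw1, hw2⟩, w', hw', hw1', hw2'⟩ := g1
        have := dist_adj hT hw x
        have := dist_adj hT hw' y
        simp only [false_iff, true_imp_iff]
        omega
      · obtain ⟨w, hw, hw1, hw2⟩ := g2
        have := dist_adj hT hw x
        have := dist_lt_of_adj_of_dist_lt hT hw hw1 hw2 h2
          (fun w' a b => g1 ⟨⟨w, hw, hw1, hw2⟩, w', a, b⟩)
        simp only [and_true, false_iff, true_iff, false_imp_iff]
        omega
      · obtain ⟨w, hw, hw1, hw2⟩ := g3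
        have := dist_adj hT hw y
        have := dist_lt_of_adj_of_dist_lt hT hw hw1 hw2 h1
          (fun w' a b => g2 ⟨w', a, b⟩)
        simp only [and_true, false_iff, true_iff, false_imp_iff]
        omega
      · simp only [and_true, false_iff, false_imp_iff]
        refine ⟨fun h => ?_, fun h => ?_⟩
        · exact g2 (exists_adj_and_forall_adj_of_dist_lt hT (by omega) h.2).1
        · exact g3 (exists_adj_and_forall_adj_of_dist_lt hT (by omega) h.2).1
    all_goals
      simp only [hc, reduceCtorEq, and_true, false_iff, true_iff, false_imp_iff, true_imp_iff] at h1 h2 h3 ⊢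
      omega

/-- The vertices that are nearer to `x` than to `y`. -/
def nearer (T : SimpleGraph V) (x y : V) : Set V := {v | T.dist v x < T.dist v y}

lemma gain_eq_ncard_nearer (hT : T.IsTree) (x y : V) : gain T x y = (nearer T x y).ncard := by
  unfold gain nearer
  congr 1
  ext v
  simp only [Set.mem_ofPred_eq, (colouring_iff_dist hT x y _ v).1]
  exact ⟨fun ⟨_, h⟩ => h.2, fun h => ⟨_, le_rfl, h⟩⟩

/-! ### The vertices nearer to one end of a geodesic -/

lemma nearer_subset_of_dist_le (hT : T.IsTree) {x a b y : V} (hab : T.Adj a b)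
    (h : T.dist x a + 1 + T.dist b y = T.dist x y) (hle : T.dist x a ≤ T.dist b y) :
    nearer T a b ⊆ nearer T x y := by
  intro v hv
  simp only [nearer, Set.mem_ofPred_eq] at hv ⊢
  have h1 := dist_eq_one_iff_adj.mpr hab
  have hax := T.dist_comm (u := a) (v := x)
  have t1 := hT.connected.dist_triangle (u := x) (v := a) (w := y)
  have t2 := hT.connected.dist_triangle (u := a) (v := b) (w := y)
  have t3 := hT.connected.dist_triangle (u := v) (v := a) (w := x)
  have hb : Between T a b y := by
    unfold Between
    omega
  have hba := T.dist_comm (u := b) (v := a)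
  rcases hb.or hT v with h2 | h2 <;> unfold Between at h2 <;> omega

lemma nearer_subset_of_le_dist (hT : T.IsTree) {x a b y : V} (hab : T.Adj a b)
    (h : T.dist x a + 1 + T.dist b y = T.dist x y) (hle : T.dist b y ≤ T.dist x a + 1) :
    nearer T x y ⊆ nearer T a b := by
  intro v hv
  simp only [nearer, Set.mem_ofPred_eq] at hv ⊢
  have h1 := dist_eq_one_iff_adj.mpr hab
  have hax := T.dist_comm (u := a) (v := x)
  have hba := T.dist_comm (u := b) (v := a)
  have hbx := T.dist_comm (u := b) (v := x)
  have t1 := hT.connected.dist_triangle (u := x) (v := b) (w := y)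
  have t2 := hT.connected.dist_triangle (u := x) (v := a) (w := b)
  have t3 := hT.connected.dist_triangle (u := v) (v := b) (w := y)
  have hb : Between T b a x := by
    unfold Between
    omega
  have hadj := dist_adj hT hab v
  have c1 := T.dist_comm (u := a) (v := v)
  have c2 := T.dist_comm (u := b) (v := v)
  rcases hb.or hT v with h2 | h2 <;> unfold Between at h2 <;> omega

lemma Between.nearer_subset (hT : T.IsTree) {x y y' : V} (h : Between T x y y') :
    nearer T x y ⊆ nearer T x y' := by
  intro v hv
  simp only [nearer, Set.mem_ofPred_eq] at hv ⊢
  have := T.dist_comm (u := y) (v := x)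
  rcases h.or hT v with h2 | h2 <;> unfold Between at h2 <;> omega

lemma compl_nearer (hT : T.IsTree) {a b : V} (h : T.Adj a b) :
    (nearer T a b)ᶜ = nearer T b a := by
  ext v
  simp only [nearer, Set.mem_ofPred_eq, Set.mem_compl_iff]
  have := dist_adj hT h v
  have c1 := T.dist_comm (u := a) (v := v)
  have c2 := T.dist_comm (u := b) (v := v)
  omega

lemma ncard_nearer_add [Finite V] (hT : T.IsTree) {a b : V} (h : T.Adj a b) :
    (nearer T a b).ncard + (nearer T b a).ncard = Nat.card V := by
  rw [← compl_nearer hT h]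
  exact Set.ncard_add_ncard_compl _

/-! ### Descendants of a vertex in a rooted tree -/

/-- The descendants of `v`, including `v` itself, when the tree has root `c`. -/
def descendants (T : SimpleGraph V) (c v : V) : Set V := {z | Between T c v z}

lemma self_mem_descendants (c v : V) : v ∈ descendants T c v := by
  simp [descendants, Between]

lemma nearer_eq_descendants (hT : T.IsTree) {c p v : V} (h : T.Adj p v)
    (hd : T.dist c v = T.dist c p + 1) : nearer T v p = descendants T c v := by
  ext z
  simp only [nearer, descendants, Set.mem_ofPred_eq]
  have h1 := dist_eq_one_iff_adj.mpr h
  have c1 := T.dist_comm (u := v) (v := p)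
  have c2 := T.dist_comm (u := v) (v := c)
  have c3 := T.dist_comm (u := p) (v := c)
  have c4 := T.dist_comm (u := z) (v := c)
  have c5 := T.dist_comm (u := z) (v := v)
  have c6 := T.dist_comm (u := z) (v := p)
  have hadj := dist_adj hT h z
  have hb : Between T v p c := by
    unfold Between
    omega
  have t := hT.connected.dist_triangle (u := c) (v := p) (w := z)
  unfold Between
  constructor
  · intro hz
    rcases hb.or hT z with h2 | h2 <;> unfold Between at h2 <;> omega
  · intro hz
    omega

lemma descendants_subset (hT : T.IsTree) {c v x : V} (h : x ∈ descendants T c v) :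
    descendants T c x ⊆ descendants T c v := by
  intro z hz
  simp only [descendants, Set.mem_ofPred_eq, Between] at *
  have t1 := hT.connected.dist_triangle (u := c) (v := v) (w := z)
  have t2 := hT.connected.dist_triangle (u := v) (v := x) (w := z)
  omega

lemma eq_of_mem_descendants_of_mem_descendants (hT : T.IsTree) {c v x : V}
    (h : x ∈ descendants T c v) (h' : v ∈ descendants T c x) : x = v := by
  simp only [descendants, Set.mem_ofPred_eq, Between] at *
  apply (hT.connected.dist_eq_zero_iff).mp
  omega

lemma ncard_descendants_lt [Finite V] (hT : T.IsTree) {c v x : V}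
    (h : x ∈ descendants T c v) (hne : x ≠ v) :
    (descendants T c x).ncard < (descendants T c v).ncard := by
  apply Set.ncard_lt_ncard _ (Set.toFinite _)
  refine ⟨descendants_subset hT h, fun hs => hne ?_⟩
  exact eq_of_mem_descendants_of_mem_descendants hT h (hs (self_mem_descendants c v))

/-- Two vertices with a common descendant are comparable. -/
lemma mem_descendants_or_mem_descendants (hT : T.IsTree) {c v x z : V}
    (hv : z ∈ descendants T c v) (hx : z ∈ descendants T c x) :
    x ∈ descendants T c v ∨ v ∈ descendants T c x := by
  simp only [descendants, Set.mem_ofPred_eq] at *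
  rcases hx.or hT v with h | h
  · exact Or.inr h.symm
  · left
    unfold Between at *
    have t := hT.connected.dist_triangle (u := c) (v := v) (w := x)
    omega

lemma exists_parent (hT : T.IsTree) {c v : V} (h : v ≠ c) :
    ∃ p, T.Adj p v ∧ T.dist c v = T.dist c p + 1 := by
  obtain ⟨p, hp, hd⟩ := exists_adj_dist_add_one hT h
  refine ⟨p, hp.symm, ?_⟩
  rw [T.dist_comm (u := c) (v := v), T.dist_comm (u := c) (v := p), hd]

/-- A proper descendant of `v` descends from a child of `v`. -/
lemma exists_child (hT : T.IsTree) {c v z : V} (h : z ∈ descendants T c v) (hne : z ≠ v) :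
    ∃ x, T.Adj v x ∧ T.dist c x = T.dist c v + 1 ∧ z ∈ descendants T c x := by
  obtain ⟨x, hx, hd⟩ := exists_adj_dist_add_one hT hne.symm
  refine ⟨x, hx, ?_⟩
  simp only [descendants, Set.mem_ofPred_eq, Between] at *
  have h1 := dist_eq_one_iff_adj.mpr hx
  have t1 := hT.connected.dist_triangle (u := c) (v := v) (w := x)
  have t2 := hT.connected.dist_triangle (u := c) (v := x) (w := z)
  constructor <;> omega

lemma parent_mem_descendants (hT : T.IsTree) {c p v x : V} (h : T.Adj p x)
    (hd : T.dist c x = T.dist c p + 1) (hx : x ∈ descendants T c v) (hne : x ≠ v) :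
    p ∈ descendants T c v := by
  simp only [descendants, Set.mem_ofPred_eq] at *
  have h1 := dist_eq_one_iff_adj.mpr h
  have hb : Between T c p x := by
    unfold Between
    omega
  have c1 := T.dist_comm (u := p) (v := v)
  rcases hb.or hT v with h2 | h2
  · have := hT.connected.pos_dist_of_ne hne
    have c2 := T.dist_comm (u := x) (v := v)
    have c3 := T.dist_comm (u := v) (v := c)
    have c4 := T.dist_comm (u := p) (v := c)
    unfold Between at *
    have t := hT.connected.dist_triangle (u := v) (v := p) (w := x)
    omega
  · unfold Between at *
    have t := hT.connected.dist_triangle (u := c) (v := v) (w := p)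
    omega

/-! ### Branches and weights -/

lemma subset_of_isSubtreeWithLeaf (hT : T.IsTree) {v u : V} {S : Set V}
    (hS : IsSubtreeWithLeaf T v S) (hu : u ∈ S) (hvu : T.Adj v u) :
    S ⊆ insert v (nearer T u v) := by
  obtain ⟨htree, hv, w, -, huniq⟩ := hS
  intro z hz
  by_cases hzv : z = v
  · exact Or.inl hzv
  right
  obtain ⟨u', hu', hd⟩ := exists_adj_dist_add_one hT (Ne.symm hzv)
  obtain ⟨p⟩ := htree.connected.preconnected ⟨v, hv⟩ ⟨z, hz⟩
  have hb : Between T v u' z := by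
    unfold Between
    rw [dist_eq_one_iff_adj.mpr hu']
    omega
  have hmem : u' ∈ (p.map (Embedding.induce S).toHom).support := mem_support_of_between hT hb _
  rw [Walk.support_map, List.mem_map] at hmem
  obtain ⟨⟨a, ha⟩, -, hau⟩ := hmem
  have hS' : u' ∈ S := by
    rw [← hau]
    exact ha
  have heq : u' = u := (huniq u' ⟨hS', hu'⟩).trans (huniq u ⟨hu, hvu⟩).symm
  subst heq
  simp only [nearer, Set.mem_ofPred_eq]
  rw [T.dist_comm (u := z) (v := u'), T.dist_comm (u := z) (v := v)]
  omega

lemma isSubtreeWithLeaf_insert_nearer (hT : T.IsTree) {v u : V} (hvu : T.Adj v u) :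
    IsSubtreeWithLeaf T v (insert v (nearer T u v)) := by
  have h1 := dist_eq_one_iff_adj.mpr hvu
  have h1' := dist_eq_one_iff_adj.mpr hvu.symm
  have hu : u ∈ insert v (nearer T u v) := by
    right
    simp only [nearer, Set.mem_ofPred_eq, dist_self]
    omega
  have hv : v ∈ insert v (nearer T u v) := Or.inl rfl
  refine ⟨⟨?_, hT.isAcyclic.induce _⟩, hv, u, ⟨hu, hvu⟩, ?_⟩
  · have key : ∀ m, ∀ z (hz : z ∈ insert v (nearer T u v)), z ∈ nearer T u v → T.dist z u = m →
        (T.induce (insert v (nearer T u v))).Reachable ⟨z, hz⟩ ⟨u, hu⟩ := by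
      intro m
      induction m with
      | zero =>
        intro z hz _ hm
        have : z = u := (hT.connected.dist_eq_zero_iff).mp hm
        subst this
        exact Reachable.refl _
      | succ m ih =>
        intro z hz hzn hm
        have hzu : z ≠ u := by
          rintro rfl
          rw [dist_self] at hm
          omega
        obtain ⟨w, hw, hd⟩ := exists_adj_dist_add_one hT hzu
        have hwn : w ∈ nearer T u v := by
          simp only [nearer, Set.mem_ofPred_eq] at hzn ⊢
          have := dist_adj hT hw v
          omega
        have hadj : (T.induce (insert v (nearer T u v))).Adj ⟨z, hz⟩ ⟨w, Or.inr hwn⟩ := hw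
        exact hadj.reachable.trans (ih w (Or.inr hwn) hwn (by omega))
    have hreach : ∀ z : ↥(insert v (nearer T u v)),
        (T.induce (insert v (nearer T u v))).Reachable z ⟨u, hu⟩ := by
      rintro ⟨z, hz⟩
      rcases hz with rfl | hz'
      · have hadj : (T.induce (insert z (nearer T u z))).Adj ⟨z, hv⟩ ⟨u, hu⟩ := hvu
        exact hadj.reachable
      · exact key _ z _ hz' rfl
    have : Nonempty ↥(insert v (nearer T u v)) := ⟨⟨u, hu⟩⟩
    exact ⟨fun a b => (hreach a).trans (hreach b).symm⟩
  · rintro w ⟨hw, hvw⟩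
    rcases hw with rfl | hw
    · exact absurd hvw (T.irrefl)
    · simp only [nearer, Set.mem_ofPred_eq] at hw
      have := dist_eq_one_iff_adj.mpr hvw.symm
      exact (hT.connected.dist_eq_zero_iff).mp (by omega)

lemma isBranch_iff (hT : T.IsTree) {v : V} {S : Set V} :
    IsBranch T v S ↔ ∃ u, T.Adj v u ∧ S = insert v (nearer T u v) := by
  constructor
  · rintro hS
    obtain ⟨-, -, u, ⟨hu, hvu⟩, -⟩ := hS.prop
    refine ⟨u, hvu, ?_⟩
    have hsub := subset_of_isSubtreeWithLeaf hT hS.prop hu hvu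
    exact hsub.antisymm (hS.le_of_ge (isSubtreeWithLeaf_insert_nearer hT hvu) hsub)
  · rintro ⟨u, hvu, rfl⟩
    refine ⟨isSubtreeWithLeaf_insert_nearer hT hvu, fun S hS hle => ?_⟩
    have hu : u ∈ nearer T u v := by
      simp only [nearer, Set.mem_ofPred_eq, dist_self]
      exact hT.connected.pos_dist_of_ne hvu.ne'
    exact subset_of_isSubtreeWithLeaf hT hS (hle (Or.inr hu)) hvu

lemma ncard_edgeSet_branch [Finite V] (hT : T.IsTree) {v u : V} (hvu : T.Adj v u) :
    (T.induce (insert v (nearer T u v))).edgeSet.ncard = (nearer T u v).ncard := by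
  classical
  have := Fintype.ofFinite V
  have htree := (isSubtreeWithLeaf_insert_nearer hT hvu).1
  have h1 := htree.card_edgeFinset
  rw [← Nat.card_eq_fintype_card, Nat.card_coe_set_eq, Set.ncard_insert_of_notMem] at h1
  · rw [← coe_edgeFinset, Set.ncard_coe_finset]
    omega
  · simp [nearer]

lemma weight_eq_sSup [Finite V] (hT : T.IsTree) (v : V) :
    weight T v = sSup {m | ∃ u, T.Adj v u ∧ (nearer T u v).ncard = m} := by
  unfold weight
  congr 1
  ext m
  simp only [Set.mem_ofPred_eq, isBranch_iff hT]
  constructor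
  · rintro ⟨S, ⟨u, hu, rfl⟩, hm⟩
    exact ⟨u, hu, (ncard_edgeSet_branch hT hu).symm.trans hm⟩
  · rintro ⟨u, hu, hm⟩
    exact ⟨_, ⟨u, hu, rfl⟩, (ncard_edgeSet_branch hT hu).trans hm⟩

lemma ncard_nearer_le_weight [Finite V] (hT : T.IsTree) {v u : V} (h : T.Adj v u) :
    (nearer T u v).ncard ≤ weight T v := by
  rw [weight_eq_sSup hT]
  apply le_csSup
  · refine ⟨Nat.card V, ?_⟩
    rintro m ⟨w, -, rfl⟩
    exact Set.ncard_le_card _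
  · exact ⟨u, h, rfl⟩

lemma weight_le [Finite V] (hT : T.IsTree) {v : V} {m : ℕ}
    (h : ∀ u, T.Adj v u → (nearer T u v).ncard ≤ m) : weight T v ≤ m := by
  rw [weight_eq_sSup hT]
  rcases Set.eq_empty_or_nonempty {m | ∃ u, T.Adj v u ∧ (nearer T u v).ncard = m} with h0 | h0
  · rw [h0]
    simp
  · apply csSup_le h0
    rintro _ ⟨u, hu, rfl⟩
    exact h u hu

lemma nearer_subset_nearer_of_ne (hT : T.IsTree) {v p x : V} (hp : T.Adj v p) (hx : T.Adj v x)
    (hne : x ≠ p) : nearer T x v ⊆ nearer T v p := by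
  intro z hz
  simp only [nearer, Set.mem_ofPred_eq] at hz ⊢
  have h1 := dist_adj hT hp z
  have h2 := dist_adj hT hx z
  have c1 := T.dist_comm (u := v) (v := z)
  have c2 := T.dist_comm (u := p) (v := z)
  have c3 := T.dist_comm (u := x) (v := z)
  by_contra hcon
  exact hne (eq_of_adj_of_dist_add_one (x := z) hT hx hp (by omega) (by omega))

/-! ### The centroid -/

lemma two_mul_ncard_descendants_lt [Finite V] (hT : T.IsTree) {c v : V}
    (hc : centroid T = {c}) (hv : v ≠ c) : 2 * (descendants T c v).ncard < Nat.card V := by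
  have hroot : v ∈ descendants T c c := by simp [descendants, Between]
  obtain ⟨z, hz, hd, hvz⟩ := exists_child hT hroot hv
  have hcz : (nearer T z c).ncard < (nearer T c z).ncard := by
    by_contra hcon
    have h1 : weight T z ≤ (nearer T z c).ncard := by
      apply weight_le hT
      intro x hx
      by_cases hxc : x = c
      · subst hxc
        omega
      · exact Set.ncard_le_ncard (nearer_subset_nearer_of_ne hT hz.symm hx hxc) (Set.toFinite _)
    have h2 := ncard_nearer_le_weight hT hz
    have hcm : c ∈ centroid T := by simp [hc]
    have hzm : z ∈ centroid T := fun u => (h1.trans h2).trans (hcm u)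
    rw [hc, Set.mem_singleton_iff] at hzm
    exact hz.ne' hzm
  have h3 := ncard_nearer_add hT hz
  rw [nearer_eq_descendants hT hz hd] at h3 hcz
  have h4 := Set.ncard_le_ncard (descendants_subset hT hvz) (Set.toFinite _)
  omega

lemma weight_add_ncard_descendants [Finite V] (hT : T.IsTree) {c v : V}
    (hc : centroid T = {c}) (hv : v ≠ c) :
    weight T v + (descendants T c v).ncard = Nat.card V := by
  obtain ⟨p, hp, hd⟩ := exists_parent hT hv
  have h1 := ncard_nearer_add hT hp
  have h2 := two_mul_ncard_descendants_lt hT hc hv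
  have h3 := ncard_nearer_le_weight hT hp.symm
  have h4 : weight T v ≤ (nearer T p v).ncard := by
    apply weight_le hT
    intro x hx
    by_cases hxp : x = p
    · rw [hxp]
    · have := Set.ncard_le_ncard (nearer_subset_nearer_of_ne hT hp.symm hx hxp) (Set.toFinite _)
      rw [nearer_eq_descendants hT hp hd] at this h1
      omega
  rw [nearer_eq_descendants hT hp hd] at h1
  omega

/-! ### Entries of the game matrix -/

/-- The vertex `p` is the parent of `v` when the tree has root `c`. -/
def IsParent (T : SimpleGraph V) (c p v : V) : Prop :=
  T.Adj p v ∧ T.dist c v = T.dist c p + 1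

lemma IsParent.ne_root {c p v : V} (h : IsParent T c p v) : v ≠ c := by
  rintro rfl
  have := h.2
  rw [dist_self] at this
  omega

lemma IsParent.dist_eq (hT : T.IsTree) {c p v x y : V} (h : IsParent T c p v)
    (hx : x ∈ descendants T c v) (hy : y ∉ descendants T c v) :
    T.dist x y = T.dist x v + 1 + T.dist p y := by
  rw [← nearer_eq_descendants hT h.1 h.2] at hx hy
  simp only [nearer, Set.mem_ofPred_eq] at hx hy
  have h1 := dist_eq_one_iff_adj.mpr h.1.symm
  have hx' := dist_adj hT h.1 x
  have hy' := dist_adj hT h.1 y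
  have c1 := T.dist_comm (u := y) (v := v)
  have c2 := T.dist_comm (u := y) (v := p)
  have c3 := T.dist_comm (u := x) (v := v)
  have c4 := T.dist_comm (u := x) (v := p)
  have c5 := T.dist_comm (u := p) (v := v)
  have hb : Between T v p y := by
    unfold Between
    omega
  rcases hb.or hT x with h2 | h2 <;> unfold Between at h2 <;> omega

lemma notMem_descendants_of_dist_lt {c v y : V} (h : T.dist c y < T.dist c v) :
    y ∉ descendants T c v := by
  simp only [descendants, Set.mem_ofPred_eq, Between]
  omega

lemma IsParent.notMem_descendants {c p v : V} (h : IsParent T c p v) :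
    p ∉ descendants T c v :=
  notMem_descendants_of_dist_lt (by have := h.2; omega)

lemma IsParent.root_notMem_descendants {c p v : V} (h : IsParent T c p v) :
    c ∉ descendants T c v :=
  notMem_descendants_of_dist_lt (by rw [h.2, dist_self]; omega)

lemma IsParent.mem_descendants {c p v : V} (h : IsParent T c p v) :
    v ∈ descendants T c p := by
  simp only [descendants, Set.mem_ofPred_eq, Between, dist_eq_one_iff_adj.mpr h.1, h.2]

/-- Descendants of distinct vertices of the same depth are distinct. -/
lemma notMem_descendants_of_ne (hT : T.IsTree) {c v x z : V} (hne : x ≠ v)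
    (hd : T.dist c x = T.dist c v) (hz : z ∈ descendants T c x) : z ∉ descendants T c v := by
  intro hz'
  apply hne
  rcases mem_descendants_or_mem_descendants hT hz' hz with h | h
  all_goals
    simp only [descendants, Set.mem_ofPred_eq, Between] at h
    first
    | exact ((hT.connected.dist_eq_zero_iff).mp (by omega)).symm
    | exact (hT.connected.dist_eq_zero_iff).mp (by omega)

lemma gameMatrix_eq (hT : T.IsTree) (x y : V) :
    gameMatrix T x y = ((nearer T x y).ncard : ℝ) := by
  simp only [gameMatrix, Matrix.of_apply, gain_eq_ncard_nearer hT]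

lemma gameMatrix_nonneg (x y : V) : 0 ≤ gameMatrix T x y := by
  simp only [gameMatrix, Matrix.of_apply]
  positivity

lemma gameMatrix_self (hT : T.IsTree) (x : V) : gameMatrix T x x = 0 := by
  rw [gameMatrix_eq hT]
  simp [nearer]

lemma cowt_eq [Finite V] (hT : T.IsTree) {c v : V} (hc : centroid T = {c}) (hv : v ≠ c) :
    cowt T v = ((descendants T c v).ncard : ℝ) := by
  have := weight_add_ncard_descendants hT hc hv
  unfold cowt wt
  rw [← this]
  push_cast
  ring

lemma two_mul_cowt_lt [Finite V] (hT : T.IsTree) {c v : V} (hc : centroid T = {c}) (hv : v ≠ c) :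
    2 * cowt T v < Nat.card V := by
  rw [cowt_eq hT hc hv]
  exact_mod_cast two_mul_ncard_descendants_lt hT hc hv

lemma cowt_pos [Finite V] (hT : T.IsTree) {c v : V} (hc : centroid T = {c}) (hv : v ≠ c) :
    0 < cowt T v := by
  rw [cowt_eq hT hc hv]
  have : 0 < (descendants T c v).ncard :=
    (Set.ncard_pos (Set.toFinite _)).mpr ⟨v, self_mem_descendants c v⟩
  exact_mod_cast this

lemma gameMatrix_le_of_between [Finite V] (hT : T.IsTree) {x y y' : V} (h : Between T x y y') :
    gameMatrix T x y ≤ gameMatrix T x y' := by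
  rw [gameMatrix_eq hT, gameMatrix_eq hT]
  exact_mod_cast Set.ncard_le_ncard (h.nearer_subset hT) (Set.toFinite _)

section Parent

variable [Finite V] {c p v x y : V}

lemma IsParent.cowt_le_gameMatrix (h : IsParent T c p v) (hT : T.IsTree) (hc : centroid T = {c})
    (hx : x ∈ descendants T c v) (hy : y ∉ descendants T c v) (hd : T.dist x v ≤ T.dist p y) :
    cowt T v ≤ gameMatrix T x y := by
  rw [cowt_eq hT hc h.ne_root, gameMatrix_eq hT, ← nearer_eq_descendants hT h.1 h.2]
  exact_mod_cast Set.ncard_le_ncard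
    (nearer_subset_of_dist_le hT h.1.symm (h.dist_eq hT hx hy).symm hd) (Set.toFinite _)

lemma IsParent.gameMatrix_le_cowt (h : IsParent T c p v) (hT : T.IsTree) (hc : centroid T = {c})
    (hx : x ∈ descendants T c v) (hy : y ∉ descendants T c v) (hd : T.dist p y ≤ T.dist x v + 1) :
    gameMatrix T x y ≤ cowt T v := by
  rw [cowt_eq hT hc h.ne_root, gameMatrix_eq hT, ← nearer_eq_descendants hT h.1 h.2]
  exact_mod_cast Set.ncard_le_ncard
    (nearer_subset_of_le_dist hT h.1.symm (h.dist_eq hT hx hy).symm hd) (Set.toFinite _)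

lemma IsParent.wt_le_gameMatrix (h : IsParent T c p v) (hT : T.IsTree) (hc : centroid T = {c})
    (hx : x ∈ descendants T c v) (hy : y ∉ descendants T c v) (hd : T.dist p y ≤ T.dist x v) :
    wt T v ≤ gameMatrix T y x := by
  have h1 := ncard_nearer_add hT h.1
  rw [nearer_eq_descendants hT h.1 h.2] at h1
  have h2 := weight_add_ncard_descendants hT hc h.ne_root
  have h3 : weight T v = (nearer T p v).ncard := by omega
  rw [gameMatrix_eq hT, wt, h3]
  have h4 := h.dist_eq hT hx hy
  have c1 := T.dist_comm (u := y) (v := p)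
  have c2 := T.dist_comm (u := v) (v := x)
  have c3 := T.dist_comm (u := x) (v := y)
  exact_mod_cast Set.ncard_le_ncard
    (nearer_subset_of_dist_le hT h.1 (by omega) (by omega)) (Set.toFinite _)

end Parent

/-! ### Best responses within a branch -/

section Branch

variable [Finite V] {c u t s y : V} {α β γ δ : ℝ}

lemma le_gameMatrix_thick (hT : T.IsTree) (hc : centroid T = {c}) (hu : IsParent T c c u)
    (hα : 0 ≤ α) (hβ : 0 ≤ β) (hbal : β * cowt T u = α * wt T u) (hy : y ∈ descendants T c u) :
    β * gameMatrix T u c ≤ α * gameMatrix T c y + β * gameMatrix T u y := by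
  have h1 : wt T u ≤ gameMatrix T c y :=
    hu.wt_le_gameMatrix hT hc hy hu.root_notMem_descendants (by simp)
  have h2 : gameMatrix T u c ≤ cowt T u :=
    hu.gameMatrix_le_cowt hT hc (self_mem_descendants c u) hu.root_notMem_descendants (by simp)
  have h3 := mul_le_mul_of_nonneg_left h1 hα
  have h4 := mul_le_mul_of_nonneg_left h2 hβ
  have h5 := mul_nonneg hβ (gameMatrix_nonneg (T := T) u y)
  linarith

lemma le_gameMatrix_medium (hT : T.IsTree) (hc : centroid T = {c}) (hu : IsParent T c c u)
    (ht : IsParent T c u t) (hmin : ∀ z ∈ descendants T c u, z ≠ u → wt T t ≤ wt T z)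
    (hα : 0 ≤ α) (hβ : 0 ≤ β) (hγ : 0 ≤ γ) (hbal : β * cowt T u = α * wt T u)
    (hbal' : γ * cowt T t = β * wt T t) (hy : y ∈ descendants T c u) :
    β * gameMatrix T u c + γ * gameMatrix T t c ≤
      α * gameMatrix T c y + β * gameMatrix T u y + γ * gameMatrix T t y := by
  have h1 : wt T u ≤ gameMatrix T c y :=
    hu.wt_le_gameMatrix hT hc hy hu.root_notMem_descendants (by simp)
  have h2 : gameMatrix T u c ≤ cowt T u :=
    hu.gameMatrix_le_cowt hT hc (self_mem_descendants c u) hu.root_notMem_descendants (by simp)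
  have h3 : gameMatrix T t c ≤ cowt T t :=
    ht.gameMatrix_le_cowt hT hc (self_mem_descendants c t) ht.root_notMem_descendants
      (by rw [dist_eq_one_iff_adj.mpr hu.1.symm]; omega)
  have e1 := mul_le_mul_of_nonneg_left h1 hα
  have e2 := mul_le_mul_of_nonneg_left h2 hβ
  have e3 := mul_le_mul_of_nonneg_left h3 hγ
  by_cases hyu : y = u
  · subst hyu
    have h4 : cowt T t ≤ gameMatrix T t y :=
      ht.cowt_le_gameMatrix hT hc (self_mem_descendants c t) ht.notMem_descendants (by simp)
    have e4 := mul_le_mul_of_nonneg_left h4 hγ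
    have e5 := mul_nonneg hβ (gameMatrix_nonneg (T := T) y y)
    linarith
  · obtain ⟨z, hz, hzd, hyz⟩ := exists_child hT hy hyu
    have hz : IsParent T c u z := ⟨hz, hzd⟩
    have h4 : wt T z ≤ gameMatrix T u y :=
      hz.wt_le_gameMatrix hT hc hyz hz.notMem_descendants (by simp)
    have h5 := hmin z hz.mem_descendants hz.1.ne'
    have e4 := mul_le_mul_of_nonneg_left (h5.trans h4) hβ
    have e5 := mul_nonneg hγ (gameMatrix_nonneg (T := T) t y)
    linarith

lemma le_gameMatrix_thin (hT : T.IsTree) (hc : centroid T = {c}) (hu : IsParent T c c u)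
    (ht : IsParent T c u t) (hs : IsParent T c t s)
    (hmin : ∀ z ∈ descendants T c u, z ≠ u → z ≠ t → wt T s ≤ wt T z)
    (hts : wt T t ≤ wt T s) (hα : 0 ≤ α) (hβ : 0 ≤ β) (hγ : 0 ≤ γ) (hδ : 0 ≤ δ)
    (hbal : α * wt T u - β * cowt T u = (wt T s - wt T t) * δ)
    (hbal' : γ * cowt T t = β * wt T t)
    (hbal'' : δ * cowt T s = γ * wt T s + (wt T t - wt T u) * α) (hy : y ∈ descendants T c u) :
    β * gameMatrix T u c + γ * gameMatrix T t c + δ * gameMatrix T s c ≤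
      α * gameMatrix T c y + β * gameMatrix T u y + γ * gameMatrix T t y
        + δ * gameMatrix T s y := by
  have duc := dist_eq_one_iff_adj.mpr hu.1.symm
  have dcu := dist_eq_one_iff_adj.mpr hu.1
  have dst := dist_eq_one_iff_adj.mpr hs.1.symm
  have hst := hs.mem_descendants
  have hco : cowt T t - cowt T s = wt T s - wt T t := by
    unfold cowt
    ring
  have h0 : 0 ≤ (wt T s - wt T t) * δ := mul_nonneg (by linarith) hδ
  have h1 : wt T u ≤ gameMatrix T c y :=
    hu.wt_le_gameMatrix hT hc hy hu.root_notMem_descendants (by simp)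
  have h2 : gameMatrix T u c ≤ cowt T u :=
    hu.gameMatrix_le_cowt hT hc (self_mem_descendants c u) hu.root_notMem_descendants (by simp)
  have h3 : gameMatrix T t c ≤ cowt T t :=
    ht.gameMatrix_le_cowt hT hc (self_mem_descendants c t) ht.root_notMem_descendants (by omega)
  have h4 : gameMatrix T s c ≤ cowt T t :=
    ht.gameMatrix_le_cowt hT hc hst ht.root_notMem_descendants (by omega)
  have e1 := mul_le_mul_of_nonneg_left h1 hα
  have e2 := mul_le_mul_of_nonneg_left h2 hβ
  have e3 := mul_le_mul_of_nonneg_left h3 hγ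
  have e4 := mul_le_mul_of_nonneg_left h4 hδ
  have hdco : δ * cowt T t - δ * cowt T s = (wt T s - wt T t) * δ := by
    rw [← mul_sub, hco]
    ring
  by_cases hyu : y = u
  · subst hyu
    have h5 : cowt T t ≤ gameMatrix T t y :=
      ht.cowt_le_gameMatrix hT hc (self_mem_descendants c t) ht.notMem_descendants (by simp)
    have h6 : cowt T s ≤ gameMatrix T s y :=
      hs.cowt_le_gameMatrix hT hc (self_mem_descendants c s)
        (fun h => ht.notMem_descendants (descendants_subset hT hst h)) (by simp)
    have e5 := mul_le_mul_of_nonneg_left h5 hγ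
    have e6 := mul_le_mul_of_nonneg_left h6 hδ
    have e7 := mul_nonneg hβ (gameMatrix_nonneg (T := T) y y)
    linarith
  obtain ⟨z, hz, hzd, hyz⟩ := exists_child hT hy hyu
  have hz : IsParent T c u z := ⟨hz, hzd⟩
  have h5 : wt T z ≤ gameMatrix T u y :=
    hz.wt_le_gameMatrix hT hc hyz hz.notMem_descendants (by simp)
  by_cases hzt : z = t
  · subst hzt
    have e5 := mul_le_mul_of_nonneg_left h5 hβ
    by_cases hyt : y = z
    · subst hyt
      have h6 : cowt T s ≤ gameMatrix T s y :=
        hs.cowt_le_gameMatrix hT hc (self_mem_descendants c s) hs.notMem_descendants (by simp)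
      have e6 := mul_le_mul_of_nonneg_left h6 hδ
      have e7 := mul_nonneg hγ (gameMatrix_nonneg (T := T) y y)
      linarith
    · obtain ⟨x, hx, hxd, hyx⟩ := exists_child hT hyz hyt
      have hx : IsParent T c z x := ⟨hx, hxd⟩
      have h6 : wt T z ≤ gameMatrix T c y :=
        hz.wt_le_gameMatrix hT hc hyz hz.root_notMem_descendants
          (by have := hT.connected.pos_dist_of_ne hyt; omega)
      have h7 : wt T x ≤ gameMatrix T z y :=
        hx.wt_le_gameMatrix hT hc hyx hx.notMem_descendants (by simp)
      have hxu : x ≠ u := by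
        rintro rfl
        have := hx.2
        have := hz.2
        omega
      have h8 := hmin x (descendants_subset hT hz.mem_descendants hx.mem_descendants) hxu hx.1.ne'
      have e6 := mul_le_mul_of_nonneg_left h6 hα
      have e7 := mul_le_mul_of_nonneg_left (h8.trans h7) hγ
      have e8 := mul_nonneg hδ (gameMatrix_nonneg (T := T) s y)
      linarith
  · have hyt : y ∉ descendants T c t :=
      notMem_descendants_of_ne hT hzt (by rw [hz.2, ht.2]) hyz
    have h6 := hmin z hz.mem_descendants hz.1.ne' hzt
    have h7 : cowt T t ≤ gameMatrix T t y :=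
      ht.cowt_le_gameMatrix hT hc (self_mem_descendants c t) hyt (by simp)
    have h8 : cowt T t ≤ gameMatrix T s y :=
      ht.cowt_le_gameMatrix hT hc hst hyt
        (by have := hT.connected.pos_dist_of_ne (Ne.symm hyu); omega)
    have e6 := mul_le_mul_of_nonneg_left (h6.trans h5) hβ
    have e7 := mul_le_mul_of_nonneg_left h7 hγ
    have e8 := mul_le_mul_of_nonneg_left h8 hδ
    have e9 : 0 ≤ β * wt T s := mul_nonneg hβ (by unfold wt; positivity)
    linarith

end Branch

/-! ### Arithmetic of thin branches -/

lemma medium_of_add_le {n a b e : ℝ} (he : 0 < e) (heb : e ≤ b) (hbea : b + e ≤ a)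
    (hn : 2 * a < n) :
    n - (n - b) + ((n - b) ^ 2 + ((n - b) - (n - a)) ^ 2) / (n + ((n - b) - (n - a))) ≤ n - e := by
  have hpos : 0 < n + ((n - b) - (n - a)) := by linarith
  rw [← le_sub_iff_add_le', div_le_iff₀ hpos]
  have h1 : 0 ≤ (n - 2 * a) * (a - e) := mul_nonneg (by linarith) (by linarith)
  rcases le_total (2 * (a - b)) a with h | h
  · have h2 : 0 ≤ (a - 2 * (a - b)) * (a + (a - b)) := mul_nonneg (by linarith) (by linarith)
    have h3 : 0 ≤ (a - b - e) * (2 * a + (a - b)) := mul_nonneg (by linarith) (by linarith)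
    nlinarith
  · have h2 : 0 ≤ a * (2 * (a - b) - a) := mul_nonneg (by linarith) (by linarith)
    have h3 : 0 ≤ (b - e) * (2 * a + (a - b)) := mul_nonneg (by linarith) (by linarith)
    nlinarith

lemma medium_of_mul_lt {n a b e : ℝ} (he : 0 < e) (heb : e ≤ b) (hba : b ≤ a)
    (hn : 2 * a < n) (h : (n - a) * e < (b - e) * (a - b)) :
    n - (n - b) + ((n - b) ^ 2 + ((n - b) - (n - a)) ^ 2) / (n + ((n - b) - (n - a))) ≤ n - e := by
  have hpos : 0 < n + ((n - b) - (n - a)) := by linarith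
  rw [← le_sub_iff_add_le', div_le_iff₀ hpos]
  by_contra hcon
  push Not at hcon
  have ha : 0 < a := by linarith
  have hnb : 0 < n - b := by linarith
  have h1 : a * (n - b) - (a - b) ^ 2 < e * (n + (a - b)) := by nlinarith
  have h2 : e * (n - b) < b * (a - b) := by nlinarith
  have h3 : (a * (n - b) - (a - b) ^ 2) * (n - b) < b * (a - b) * (n + (a - b)) := by
    calc (a * (n - b) - (a - b) ^ 2) * (n - b) < e * (n + (a - b)) * (n - b) :=
          mul_lt_mul_of_pos_right h1 hnb
      _ = e * (n - b) * (n + (a - b)) := by ring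
      _ ≤ b * (a - b) * (n + (a - b)) := mul_le_mul_of_nonneg_right h2.le (by linarith)
  have h4 : a * (n - a) ≤ a * (n - b) - (a - b) ^ 2 := by nlinarith [mul_nonneg (by linarith : (0:ℝ) ≤ b) (sub_nonneg.mpr hba)]
  have h5 : a * (n - a) * (n / 2) ≤ (a * (n - b) - (a - b) ^ 2) * (n - b) :=
    mul_le_mul h4 (by linarith) (by linarith) ((mul_nonneg ha.le (by linarith)).trans h4)
  have h6 : b * (a - b) ≤ a ^ 2 / 4 := by nlinarith [sq_nonneg (a - 2 * b)]
  have h7 : b * (a - b) * (n + (a - b)) ≤ a ^ 2 / 4 * (3 / 2 * n) :=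
    mul_le_mul h6 (by linarith) (by linarith) (by positivity)
  have h8 : a * (n / 2) * (n / 2) ≤ a * (n - a) * (n / 2) := by
    apply mul_le_mul_of_nonneg_right _ (by linarith)
    exact mul_le_mul_of_nonneg_left (by linarith) ha.le
  have h9 : a * n * (2 * a) ≤ a * n * n :=
    mul_le_mul_of_nonneg_left hn.le (mul_nonneg ha.le (by linarith))
  nlinarith [mul_pos ha (mul_pos ha (by linarith : 0 < n))]

lemma not_medium_of_branchType_eq_thin {u t s : V} (h : branchType T u t s = BranchType.thin) :
    ¬ ((Nat.card V : ℝ) - wt T t + (wt T t ^ 2 + (wt T t - wt T u) ^ 2)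
      / (Nat.card V + (wt T t - wt T u)) ≤ wt T s) := by
  unfold branchType at h
  simp only [] at h
  split_ifs at h with h1 h2
  exact h2

lemma wt_eq (v : V) : wt T v = Nat.card V - cowt T v := by
  unfold cowt
  ring

lemma wt_le_wt {u v : V} : wt T u ≤ wt T v ↔ weight T u ≤ weight T v := by
  unfold wt
  exact Nat.cast_le

section Balance

variable {α : ℝ} {u t s : V}

lemma baseBeta_mul_cowt (hu : cowt T u ≠ 0) : baseBeta T α u * cowt T u = α * wt T u := by
  unfold baseBeta
  field_simp

lemma mediumGamma_mul_cowt (ht : cowt T t ≠ 0) :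
    mediumGamma T α u t * cowt T t = baseBeta T α u * wt T t := by
  unfold mediumGamma
  field_simp

lemma thinGamma_mul_cowt (ht : cowt T t ≠ 0) :
    thinGamma T α u t s * cowt T t = thinBeta T α u t s * wt T t := by
  unfold thinGamma
  field_simp

lemma thinDelta_mul_cowt (hs : cowt T s ≠ 0) :
    thinDelta T α u t s * cowt T s = thinGamma T α u t s * wt T s + (wt T t - wt T u) * α := by
  unfold thinDelta
  field_simp

lemma thin_denominator_pos (hu : 0 < cowt T u) (ht : 0 < cowt T t) (hs : 0 < cowt T s)
    (hts : wt T t ≤ wt T s) :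
    0 < cowt T s * cowt T u * cowt T t + wt T s * wt T t * (wt T s - wt T t) := by
  have h1 : 0 ≤ wt T s * wt T t * (wt T s - wt T t) :=
    mul_nonneg (mul_nonneg (by unfold wt; positivity) (by unfold wt; positivity)) (by linarith)
  positivity

lemma thinBeta_balance (hu : 0 < cowt T u) (ht : 0 < cowt T t) (hs : 0 < cowt T s)
    (hts : wt T t ≤ wt T s) :
    α * wt T u - thinBeta T α u t s * cowt T u = (wt T s - wt T t) * thinDelta T α u t s := by
  have hD := (thin_denominator_pos hu ht hs hts).ne'
  have h1 : thinBeta T α u t s *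
      (cowt T s * cowt T u * cowt T t + wt T s * wt T t * (wt T s - wt T t)) =
      cowt T t * (wt T u * cowt T s + (wt T t - wt T s) * (wt T t - wt T u)) * α := by
    unfold thinBeta
    rw [div_mul_eq_mul_div, div_mul_cancel₀ _ hD]
  have h2 := thinGamma_mul_cowt (T := T) (α := α) (u := u) (s := s) ht.ne'
  have h3 := thinDelta_mul_cowt (T := T) (α := α) (u := u) (t := t) hs.ne'
  apply mul_right_cancel₀ (mul_ne_zero ht.ne' hs.ne')
  linear_combination (-1) * h1 - (wt T s - wt T t) * cowt T t * h3
    - (wt T s - wt T t) * wt T s * h2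

end Balance

/-! ### The strategy on a branch -/

lemma branchStrategy_smul (α : ℝ) (l : List V) :
    branchStrategy T α l = α • branchStrategy T 1 l := by
  rcases l with _ | ⟨u, _ | ⟨t, _ | ⟨s, l⟩⟩⟩
  · simp [branchStrategy]
  · simp only [branchStrategy, baseBeta, smul_smul]
    ring_nf
  · simp only [branchStrategy, baseBeta, smul_smul]
    ring_nf
  · simp only [branchStrategy]
    cases branchType T u t s
    · simp only [baseBeta, smul_smul]
      ring_nf
    · simp only [baseBeta, mediumGamma, smul_add, smul_smul]
      ring_nf
    · simp only [thinBeta, thinGamma, thinDelta, smul_add, smul_smul]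
      ring_nf

lemma pureStrategy_nonneg (v x : V) : 0 ≤ pureStrategy v x := by
  classical
  unfold pureStrategy
  by_cases h : x = v
  · subst h
    simp
  · simp [h]

lemma pureStrategy_of_ne {v x : V} (h : x ≠ v) : pureStrategy v x = 0 := by
  unfold pureStrategy
  simp [h]

lemma pureStrategy_self (v : V) : pureStrategy v v = 1 := by
  unfold pureStrategy
  simp

lemma branchStrategy_of_notMem {α : ℝ} {l : List V} {v : V} (h : v ∉ l) :
    branchStrategy T α l v = 0 := by
  rcases l with _ | ⟨u, _ | ⟨t, _ | ⟨s, l⟩⟩⟩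
  · simp [branchStrategy]
  · simp only [List.mem_cons, not_or] at h
    simp [branchStrategy, pureStrategy_of_ne h.1]
  · simp only [List.mem_cons, not_or] at h
    simp [branchStrategy, pureStrategy_of_ne h.1]
  · simp only [List.mem_cons, not_or] at h
    simp only [branchStrategy]
    cases branchType T u t s <;>
      simp [pureStrategy_of_ne h.1, pureStrategy_of_ne h.2.1, pureStrategy_of_ne h.2.2.1]

section Enumeration

variable [Finite V] {c : V} {S : Set V} {l : List V}

/-- The vertex of lowest weight of a branch is adjacent to the centroid. -/
lemma IsSortedEnumeration.head_isParent (hT : T.IsTree) (hc : centroid T = {c}) {u : V}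
    (hS : IsBranch T c S) (hl : IsSortedEnumeration T c S (u :: l)) :
    IsParent T c c u ∧ ∀ v, v ∈ u :: l ↔ v ∈ descendants T c u := by
  obtain ⟨r, hr, rfl⟩ := (isBranch_iff hT).mp hS
  have hr' : IsParent T c c r := ⟨hr, by rw [dist_eq_one_iff_adj.mpr hr, dist_self]⟩
  rw [nearer_eq_descendants hT hr'.1 hr'.2] at hl
  obtain ⟨-, hmem, hsort⟩ := hl
  have hmem' : ∀ v, v ∈ u :: l ↔ v ∈ descendants T c r := by
    intro v
    rw [hmem v, Set.mem_insert_iff]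
    constructor
    · rintro ⟨h | h, hv⟩
      · exact absurd h hv
      · exact h
    · intro h
      refine ⟨Or.inr h, ?_⟩
      rintro rfl
      exact hr'.root_notMem_descendants h
  have hu : u ∈ descendants T c r := (hmem' u).mp List.mem_cons_self
  have hur : u = r := by
    by_contra hne
    have h1 := ncard_descendants_lt hT hu hne
    have h2 := (hmem' r).mpr (self_mem_descendants c r)
    have h3 := (List.pairwise_cons.mp hsort).1 r
      ((List.mem_cons.mp h2).resolve_left (Ne.symm hne))
    have huc : u ≠ c := by
      rintro rfl
      exact hr'.root_notMem_descendants hu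
    have h4 := weight_add_ncard_descendants hT hc huc
    have h5 := weight_add_ncard_descendants hT hc hr'.ne_root
    omega
  subst hur
  exact ⟨hr', hmem'⟩

lemma weight_lt_of_isParent (hT : T.IsTree) (hc : centroid T = {c}) {p v : V}
    (h : IsParent T c p v) (hp : p ≠ c) : weight T p < weight T v := by
  have h1 := ncard_descendants_lt hT h.mem_descendants h.1.ne'
  have h2 := weight_add_ncard_descendants hT hc h.ne_root
  have h3 := weight_add_ncard_descendants hT hc hp
  omega

/-- In an enumeration by nondecreasing weight, the parent of a vertex of the branch other than the
first one comes earlier. -/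
lemma IsSortedEnumeration.exists_isParent (hT : T.IsTree) (hc : centroid T = {c}) {u v : V}
    {l₁ l₂ : List V} (hS : IsBranch T c S)
    (hl : IsSortedEnumeration T c S (u :: l₁ ++ v :: l₂)) :
    ∃ p ∈ u :: l₁, IsParent T c p v := by
  obtain ⟨hu, hmem⟩ := hl.head_isParent hT hc hS
  have hv : v ∈ descendants T c u := (hmem v).mp (by simp)
  have hvc : v ≠ c := ((hl.2.1 v).mp (by simp)).2
  have hvu : v ≠ u := by
    rintro rfl
    have := hl.1
    simp at this
  obtain ⟨p, hp⟩ := exists_parent hT hvc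
  have hp : IsParent T c p v := hp
  have hpu := parent_mem_descendants hT hp.1 hp.2 hv hvu
  have hpm : p ∈ u :: l₁ ++ v :: l₂ := (hmem p).mpr hpu
  refine ⟨p, ?_, hp⟩
  rcases List.mem_append.mp hpm with h | h
  · exact h
  · exfalso
    have hpc : p ≠ c := ((hl.2.1 p).mp hpm).2
    have hlt := weight_lt_of_isParent hT hc hp hpc
    have hsort := (List.pairwise_append.mp hl.2.2).2.1
    have := (List.pairwise_cons.mp hsort).1 p ((List.mem_cons.mp h).resolve_left hp.1.ne)
    omega

/-- In a thin branch, the vertex of third lowest weight is a child of the vertex of second lowest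
weight. -/
lemma isParent_of_branchType_eq_thin (hT : T.IsTree) (hc : centroid T = {c}) {u t s : V}
    (hS : IsBranch T c S) (hl : IsSortedEnumeration T c S (u :: t :: s :: l))
    (hthin : branchType T u t s = BranchType.thin) : IsParent T c u t ∧ IsParent T c t s := by
  obtain ⟨p, hp, hpt⟩ := IsSortedEnumeration.exists_isParent (l₁ := []) hT hc hS hl
  rw [List.mem_singleton] at hp
  subst hp
  refine ⟨hpt, ?_⟩
  obtain ⟨q, hq, hqs⟩ := IsSortedEnumeration.exists_isParent (l₁ := [t]) hT hc hS hl
  simp only [List.mem_cons, List.not_mem_nil, or_false] at hq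
  rcases hq with rfl | rfl
  · exfalso
    have hu := (hl.head_isParent hT hc hS).1.ne_root
    have hts : t ≠ s := by
      have := hl.1
      simp only [List.nodup_cons, List.mem_cons, not_or] at this
      exact this.2.1.1
    have hle : weight T t ≤ weight T s :=
      (List.pairwise_cons.mp (List.pairwise_cons.mp hl.2.2).2).1 s List.mem_cons_self
    have hdisj : Disjoint (descendants T c t) (descendants T c s) :=
      Set.disjoint_left.mpr fun z hz =>
        notMem_descendants_of_ne hT hts (by rw [hpt.2, hqs.2]) hz
    have hcard := Set.ncard_union_eq hdisj (Set.toFinite _) (Set.toFinite _)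
    have hsub := Set.ncard_le_ncard
      (Set.union_subset (descendants_subset hT hpt.mem_descendants)
        (descendants_subset hT hqs.mem_descendants)) (Set.toFinite _)
    rw [hcard] at hsub
    have hsub' : cowt T t + cowt T s ≤ cowt T q := by
      rw [cowt_eq hT hc hu, cowt_eq hT hc hpt.ne_root, cowt_eq hT hc hqs.ne_root]
      exact_mod_cast hsub
    apply not_medium_of_branchType_eq_thin hthin
    rw [← wt_le_wt (T := T), wt_eq, wt_eq] at hle
    rw [wt_eq t, wt_eq s, wt_eq q]
    exact medium_of_add_le (cowt_pos hT hc hqs.ne_root) (by linarith) hsub'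
      (two_mul_cowt_lt hT hc hu)
  · exact hqs

lemma thinBeta_nonneg (hT : T.IsTree) (hc : centroid T = {c}) {u t s : V} {α : ℝ} (hα : 0 ≤ α)
    (hu : u ≠ c) (ht : t ≠ c) (hs : s ≠ c) (hut : wt T u ≤ wt T t) (hts : wt T t ≤ wt T s)
    (hthin : branchType T u t s = BranchType.thin) : 0 ≤ thinBeta T α u t s := by
  have hu' := cowt_pos hT hc hu
  have ht' := cowt_pos hT hc ht
  have hs' := cowt_pos hT hc hs
  have hD := thin_denominator_pos hu' ht' hs' hts
  unfold thinBeta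
  refine mul_nonneg (div_nonneg (mul_nonneg ht'.le ?_) hD.le) hα
  by_contra hcon
  apply not_medium_of_branchType_eq_thin hthin
  rw [wt_eq u, wt_eq t, wt_eq s] at *
  exact medium_of_mul_lt hs' (by linarith) (by linarith) (two_mul_cowt_lt hT hc hu)
    (by nlinarith)

lemma branchStrategy_nonneg (hT : T.IsTree) (hc : centroid T = {c}) {α : ℝ} (hα : 0 ≤ α)
    (hl : IsSortedEnumeration T c S l) (x : V) : 0 ≤ branchStrategy T α l x := by
  have hco : ∀ v ∈ l, 0 < cowt T v := fun v hv => cowt_pos hT hc ((hl.2.1 v).mp hv).2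
  have hwt : ∀ v, 0 ≤ wt T v := fun v => by unfold wt; positivity
  have hbase : ∀ v ∈ l, 0 ≤ baseBeta T α v := fun v hv =>
    mul_nonneg (div_nonneg (hwt v) (hco v hv).le) hα
  have hpure := fun v => pureStrategy_nonneg v x
  rcases l with _ | ⟨u, _ | ⟨t, _ | ⟨s, l⟩⟩⟩
  · simp [branchStrategy]
  · exact mul_nonneg (hbase u (by simp)) (hpure u)
  · exact mul_nonneg (hbase u (by simp)) (hpure u)
  · simp only [branchStrategy]
    have hu := hco u (by simp)
    have ht := hco t (by simp)
    have hs := hco s (by simp)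
    have hβ := hbase u (by simp)
    cases htype : branchType T u t s
    · exact mul_nonneg hβ (hpure u)
    · have hγ : 0 ≤ mediumGamma T α u t := mul_nonneg (div_nonneg (hwt t) ht.le) hβ
      exact add_nonneg (mul_nonneg hβ (hpure u)) (mul_nonneg hγ (hpure t))
    · have hsort := hl.2.2
      simp only [List.pairwise_cons, List.mem_cons, ← wt_le_wt (T := T)] at hsort
      have hut : wt T u ≤ wt T t := hsort.1 t (by simp)
      have hts : wt T t ≤ wt T s := hsort.2.1 s (by simp)
      have hne : ∀ v ∈ u :: t :: s :: l, v ≠ c := fun v hv => ((hl.2.1 v).mp hv).2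
      have hβ := thinBeta_nonneg hT hc hα (hne u (by simp)) (hne t (by simp)) (hne s (by simp))
        hut hts htype
      have hγ : 0 ≤ thinGamma T α u t s := mul_nonneg (div_nonneg (hwt t) ht.le) hβ
      have hδ : 0 ≤ thinDelta T α u t s :=
        add_nonneg (mul_nonneg (div_nonneg (hwt s) hs.le) hγ)
          (mul_nonneg (div_nonneg (by linarith) hs.le) hα)
      exact add_nonneg (add_nonneg (mul_nonneg hβ (hpure u)) (mul_nonneg hγ (hpure t)))
        (mul_nonneg hδ (hpure s))

end Enumeration

lemma pureStrategy_dotProduct [Fintype V] (v : V) (f : V → ℝ) : pureStrategy v ⬝ᵥ f = f v := by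
  classical
  unfold pureStrategy
  rw [single_one_dotProduct]

section BestResponse

variable [Fintype V] {c : V} {S : Set V} {l : List V}

/-- Within a branch at the centroid, Player 2 does not gain by leaving the centroid. -/
lemma branchStrategy_dotProduct_le (hT : T.IsTree) (hc : centroid T = {c}) {α : ℝ} (hα : 0 ≤ α)
    (hS : IsBranch T c S) (hl : IsSortedEnumeration T c S l) {y : V} (hy : y ∈ l) :
    branchStrategy T α l ⬝ᵥ (fun x => gameMatrix T x c) ≤
      α * gameMatrix T c y + branchStrategy T α l ⬝ᵥ (fun x => gameMatrix T x y) := by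
  have hco : ∀ v ∈ l, 0 < cowt T v := fun v hv => cowt_pos hT hc ((hl.2.1 v).mp hv).2
  have hwt : ∀ v, 0 ≤ wt T v := fun v => by unfold wt; positivity
  have hbase : ∀ v ∈ l, 0 ≤ baseBeta T α v := fun v hv =>
    mul_nonneg (div_nonneg (hwt v) (hco v hv).le) hα
  rcases l with _ | ⟨u, l⟩
  · simp at hy
  obtain ⟨hu, hmem⟩ := hl.head_isParent hT hc hS
  have hyu := (hmem y).mp hy
  have hbu := hbase u (by simp)
  have hu0 := (hco u (by simp)).ne'
  have hbal := baseBeta_mul_cowt (T := T) (α := α) hu0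
  have hthick := le_gameMatrix_thick hT hc hu hα hbu hbal hyu
  rcases l with _ | ⟨t, _ | ⟨s, l⟩⟩
  · simpa only [branchStrategy, smul_dotProduct, pureStrategy_dotProduct, smul_eq_mul]
  · simpa only [branchStrategy, smul_dotProduct, pureStrategy_dotProduct, smul_eq_mul]
  simp only [branchStrategy]
  have hsort := hl.2.2
  simp only [List.pairwise_cons, List.mem_cons, ← wt_le_wt (T := T)] at hsort
  have hut : wt T u ≤ wt T t := hsort.1 t (by simp)
  have hts : wt T t ≤ wt T s := hsort.2.1 s (by simp)
  have ht := hco t (by simp)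
  have hs := hco s (by simp)
  cases htype : branchType T u t s
  · simpa only [smul_dotProduct, pureStrategy_dotProduct, smul_eq_mul]
  · obtain ⟨p, hp, hpt⟩ := IsSortedEnumeration.exists_isParent (l₁ := []) hT hc hS hl
    rw [List.mem_singleton] at hp
    subst hp
    have hγ : 0 ≤ mediumGamma T α p t := mul_nonneg (div_nonneg (hwt t) ht.le) hbu
    have hmin : ∀ z ∈ descendants T c p, z ≠ p → wt T t ≤ wt T z := by
      intro z hz hzp
      have hz' := (List.mem_cons.mp ((hmem z).mpr hz)).resolve_left hzp
      rcases List.mem_cons.mp hz' with rfl | hz''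
      · exact le_rfl
      · exact hsort.2.1 z (List.mem_cons.mp hz'')
    have := le_gameMatrix_medium hT hc hu hpt hmin hα hbu hγ hbal (mediumGamma_mul_cowt ht.ne') hyu
    simpa only [add_dotProduct, smul_dotProduct, pureStrategy_dotProduct, smul_eq_mul, ← add_assoc]
  · obtain ⟨hpt, hps⟩ := isParent_of_branchType_eq_thin hT hc hS hl htype
    have hβ := thinBeta_nonneg hT hc hα hu.ne_root hpt.ne_root hps.ne_root hut hts htype
    have hγ : 0 ≤ thinGamma T α u t s := mul_nonneg (div_nonneg (hwt t) ht.le) hβ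
    have hδ : 0 ≤ thinDelta T α u t s :=
      add_nonneg (mul_nonneg (div_nonneg (hwt s) hs.le) hγ)
        (mul_nonneg (div_nonneg (by linarith) hs.le) hα)
    have hmin : ∀ z ∈ descendants T c u, z ≠ u → z ≠ t → wt T s ≤ wt T z := by
      intro z hz hzu hzt
      have hz' := (List.mem_cons.mp
        ((List.mem_cons.mp ((hmem z).mpr hz)).resolve_left hzu)).resolve_left hzt
      rcases List.mem_cons.mp hz' with rfl | hz''
      · exact le_rfl
      · exact hsort.2.2.1 z hz''
    have := le_gameMatrix_thin hT hc hu hpt hps hmin hts hα hβ hγ hδ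
      (thinBeta_balance (hco u (by simp)) ht hs hts) (thinGamma_mul_cowt ht.ne')
      (thinDelta_mul_cowt hs.ne') hyu
    simpa only [add_dotProduct, smul_dotProduct, pureStrategy_dotProduct, smul_eq_mul, ← add_assoc]

/-- A vertex of another branch gains when Player 2 moves away from the centroid. -/
lemma gameMatrix_le_of_ne_branch (hT : T.IsTree) {S' : Set V} (hS : IsBranch T c S)
    (hS' : IsBranch T c S') (hne : S ≠ S') {x y : V} (hx : x ∈ S) (hy : y ∈ S') :
    gameMatrix T x c ≤ gameMatrix T x y := by
  apply gameMatrix_le_of_between hT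
  obtain ⟨u, hu, rfl⟩ := (isBranch_iff hT).mp hS
  obtain ⟨v, hv, rfl⟩ := (isBranch_iff hT).mp hS'
  have huv : v ≠ u := by
    rintro rfl
    exact hne rfl
  have hu' : IsParent T c c u := ⟨hu, by rw [dist_eq_one_iff_adj.mpr hu, dist_self]⟩
  have hv' : IsParent T c c v := ⟨hv, by rw [dist_eq_one_iff_adj.mpr hv, dist_self]⟩
  rw [nearer_eq_descendants hT hu hu'.2] at hx
  rw [nearer_eq_descendants hT hv hv'.2] at hy
  unfold Between
  rcases hx with rfl | hx
  · simp
  rcases hy with rfl | hy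
  · simp
  have h1 := hu'.dist_eq hT hx (notMem_descendants_of_ne hT huv (by rw [hu'.2, hv'.2]) hy)
  have h2 := hu'.dist_eq hT hx hu'.root_notMem_descendants
  rw [dist_self] at h2
  omega

end BestResponse

/-! ### The strategies of the algorithm -/

section Strategy

variable {c : V} {d : ℕ} {B : Fin d → Set V}
  {L : Fin d → List V}

lemma IsBranchOrdering.isBranch (hB : IsBranchOrdering T c B L) (i : Fin d) :
    IsBranch T c (B i) := by
  have : B i ∈ Set.range B := ⟨i, rfl⟩
  rwa [hB.range_eq] at this

lemma IsBranchOrdering.exists_mem (hT : T.IsTree) (hB : IsBranchOrdering T c B L) {y : V}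
    (hy : y ≠ c) : ∃ i, y ∈ L i := by
  have hroot : y ∈ descendants T c c := by simp [descendants, Between]
  obtain ⟨u, hu, hd, hyu⟩ := exists_child hT hroot hy
  have hbr : IsBranch T c (insert c (nearer T u c)) := (isBranch_iff hT).mpr ⟨u, hu, rfl⟩
  have : insert c (nearer T u c) ∈ Set.range B := by rwa [hB.range_eq]
  obtain ⟨i, hi⟩ := this
  refine ⟨i, ((hB.enumeration i).2.1 y).mpr ⟨?_, hy⟩⟩
  rw [hi, nearer_eq_descendants hT hu hd]
  exact Or.inr hyu

lemma spread_smul (i : ℕ) (α : ℝ) : spread T c L i α = α • spread T c L i 1 := by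
  unfold spread
  rw [smul_add, one_smul, Finset.smul_sum]
  congr 1
  exact Finset.sum_congr rfl fun j _ => branchStrategy_smul α (L j)

variable [Fintype V]

lemma spread_nonneg (hT : T.IsTree) (hc : centroid T = {c}) (hB : IsBranchOrdering T c B L)
    (i : ℕ) {α : ℝ} (hα : 0 ≤ α) (v : V) : 0 ≤ spread T c L i α v := by
  unfold spread
  rw [Pi.add_apply, Finset.sum_apply]
  exact add_nonneg (mul_nonneg hα (pureStrategy_nonneg c v))
    (Finset.sum_nonneg fun j _ => branchStrategy_nonneg hT hc hα (hB.enumeration j) v)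

lemma sum_spread_one_pos (hT : T.IsTree) (hc : centroid T = {c}) (hB : IsBranchOrdering T c B L)
    (i : ℕ) : 0 < ∑ v, spread T c L i 1 v := by
  refine Finset.sum_pos' (fun v _ => spread_nonneg hT hc hB i zero_le_one v)
    ⟨c, Finset.mem_univ c, ?_⟩
  unfold spread
  rw [Pi.add_apply, Finset.sum_apply, Pi.smul_apply, pureStrategy_self, one_smul]
  have := Finset.sum_nonneg fun j (_ : j ∈ Finset.univ.filter fun j : Fin d => j.val < i) =>
    branchStrategy_nonneg hT hc zero_le_one (hB.enumeration j) c
  linarith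

lemma centroidProb_nonneg (hT : T.IsTree) (hc : centroid T = {c}) (hB : IsBranchOrdering T c B L)
    (i : ℕ) : 0 ≤ centroidProb T c L i :=
  inv_nonneg.mpr (sum_spread_one_pos hT hc hB i).le

lemma cssStrategy_mem_stdSimplex (hT : T.IsTree) (hc : centroid T = {c})
    (hB : IsBranchOrdering T c B L) (i : ℕ) : cssStrategy T c L i ∈ stdSimplex ℝ V := by
  refine ⟨spread_nonneg hT hc hB i (centroidProb_nonneg hT hc hB i), ?_⟩
  unfold cssStrategy
  rw [spread_smul]
  simp only [Pi.smul_apply, smul_eq_mul]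
  rw [← Finset.mul_sum]
  exact inv_mul_cancel₀ (sum_spread_one_pos hT hc hB i).ne'

lemma expectedGain_pureStrategy (X : V → ℝ) (y : V) :
    expectedGain T X (pureStrategy y) = X ⬝ᵥ fun x => gameMatrix T x y := by
  unfold expectedGain
  congr 1
  funext x
  rw [Matrix.mulVec, dotProduct_comm, pureStrategy_dotProduct]

lemma expectedGain_eq_sum (X Y : V → ℝ) :
    expectedGain T X Y = ∑ y, Y y * expectedGain T X (pureStrategy y) := by
  simp only [expectedGain_pureStrategy]
  unfold expectedGain
  rw [Matrix.dotProduct_mulVec, dotProduct_comm]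
  rfl

lemma spread_dotProduct (i : ℕ) (α : ℝ) (f : V → ℝ) :
    spread T c L i α ⬝ᵥ f =
      α * f c + ∑ j : Fin d with j.val < i, branchStrategy T α (L j) ⬝ᵥ f := by
  unfold spread
  rw [add_dotProduct, smul_dotProduct, pureStrategy_dotProduct, sum_dotProduct, smul_eq_mul]

/-- The centroid is a best response of Player 2 among the pure strategies. -/
lemma spread_dotProduct_le (hT : T.IsTree) (hc : centroid T = {c}) (hB : IsBranchOrdering T c B L)
    (i : ℕ) {α : ℝ} (hα : 0 ≤ α) (y : V) :
    spread T c L i α ⬝ᵥ (fun x => gameMatrix T x c) ≤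
      spread T c L i α ⬝ᵥ (fun x => gameMatrix T x y) := by
  classical
  by_cases hyc : y = c
  · rw [hyc]
  obtain ⟨j₀, hj₀⟩ := hB.exists_mem hT hyc
  have hother : ∀ j, j ≠ j₀ → branchStrategy T α (L j) ⬝ᵥ (fun x => gameMatrix T x c) ≤
      branchStrategy T α (L j) ⬝ᵥ (fun x => gameMatrix T x y) := by
    intro j hj
    apply Finset.sum_le_sum
    intro x _
    by_cases hx : x ∈ L j
    · refine mul_le_mul_of_nonneg_left ?_
        (branchStrategy_nonneg hT hc hα (hB.enumeration j) x)
      exact gameMatrix_le_of_ne_branch hT (hB.isBranch j) (hB.isBranch j₀)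
        (fun h => hj (hB.injective h)) (((hB.enumeration j).2.1 x).mp hx).1
        (((hB.enumeration j₀).2.1 y).mp hj₀).1
    · rw [branchStrategy_of_notMem hx, zero_mul, zero_mul]
  have hsame := branchStrategy_dotProduct_le hT hc hα (hB.isBranch j₀) (hB.enumeration j₀) hj₀
  have hcy := mul_nonneg hα (gameMatrix_nonneg (T := T) c y)
  rw [spread_dotProduct, spread_dotProduct, gameMatrix_self hT, mul_zero, zero_add]
  by_cases hmem : j₀ ∈ Finset.univ.filter fun j : Fin d => j.val < i
  · rw [← Finset.add_sum_erase _ _ hmem, ← Finset.add_sum_erase _ _ hmem, ← add_assoc]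
    exact add_le_add hsame (Finset.sum_le_sum fun j hj => hother j (Finset.ne_of_mem_erase hj))
  · have := Finset.sum_le_sum fun j (hj : j ∈ Finset.univ.filter fun j : Fin d => j.val < i) =>
      hother j (fun h => hmem (h ▸ hj))
    linarith

lemma pureStrategy_mem_stdSimplex (v : V) : pureStrategy v ∈ stdSimplex ℝ V := by
  classical
  refine ⟨pureStrategy_nonneg v, ?_⟩
  unfold pureStrategy
  simp

lemma expectedGain_centroid_le (hT : T.IsTree) (hc : centroid T = {c})
    (hB : IsBranchOrdering T c B L) (i : ℕ) {Y : V → ℝ} (hY : Y ∈ stdSimplex ℝ V) :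
    expectedGain T (cssStrategy T c L i) (pureStrategy c) ≤
      expectedGain T (cssStrategy T c L i) Y := by
  rw [expectedGain_eq_sum _ Y]
  calc expectedGain T (cssStrategy T c L i) (pureStrategy c)
      = ∑ y, Y y * expectedGain T (cssStrategy T c L i) (pureStrategy c) := by
        rw [← Finset.sum_mul, hY.2, one_mul]
    _ ≤ ∑ y, Y y * expectedGain T (cssStrategy T c L i) (pureStrategy y) := by
        refine Finset.sum_le_sum fun y _ => mul_le_mul_of_nonneg_left ?_ (hY.1 y)
        rw [expectedGain_pureStrategy, expectedGain_pureStrategy]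
        exact spread_dotProduct_le hT hc hB i (centroidProb_nonneg hT hc hB i) y

end Strategy

end CompetitiveDiffusion

theorem mainTheorem3 {V : Type*} [Fintype V] (T : SimpleGraph V) (hT : T.IsTree)
    (c : V) (hc : CompetitiveDiffusion.centroid T = {c})
    (d : ℕ) (B : Fin d → Set V) (L : Fin d → List V)
    (hB : CompetitiveDiffusion.IsBranchOrdering T c B L)
    (k : ℕ) (hk : CompetitiveDiffusion.Returns T c L k) :
    CompetitiveDiffusion.cssStrategy T c L k ∈ stdSimplex ℝ V ∧
    CompetitiveDiffusion.guaranteedGain T (CompetitiveDiffusion.cssStrategy T c L k) =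
      CompetitiveDiffusion.expectedGain T (CompetitiveDiffusion.cssStrategy T c L k)
        (CompetitiveDiffusion.pureStrategy c) ∧
    ∀ Y ∈ stdSimplex ℝ V,
      CompetitiveDiffusion.expectedGain T (CompetitiveDiffusion.cssStrategy T c L k)
          (CompetitiveDiffusion.pureStrategy c) ≤
        CompetitiveDiffusion.expectedGain T (CompetitiveDiffusion.cssStrategy T c L k) Y := by
  have hle := fun Y (hY : Y ∈ stdSimplex ℝ V) =>
    CompetitiveDiffusion.expectedGain_centroid_le hT hc hB k hY
  refine ⟨CompetitiveDiffusion.cssStrategy_mem_stdSimplex hT hc hB k, ?_, hle⟩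
  apply IsLeast.csInf_eq
  refine ⟨⟨_, CompetitiveDiffusion.pureStrategy_mem_stdSimplex c, rfl⟩, ?_⟩
  rintro _ ⟨Y, hY, rfl⟩
  exact hle Y hY
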